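/- Let $\theta_m>0$. Consider channels with inputs $x\in\mathcal X=[0,\infty)$ and outputs in $[0,\infty)$, where the main channel $w_{Y|X}$ and the warden's channel $w_{Z|X}$ have the transition densities $$p_x(y)=\frac{1}{\theta_m^2x+1}\,e^{-y/(\theta_m^2x+1)},\qquad q_x(z)=\frac{1}{x+1}\,e^{-z/(x+1)} .$$ For a probability measure $\mu$ on $\mathcal X$, let $I(\mu,w_{Y|X})$ be the mutual information between an input $X\sim\mu$ and the corresponding output $Y$ of the main channel, let $w_{Z|X}\circ\mu$ be the law of the output of the warden's channel, and let $D(\cdot\|\cdot)$ denote relative entropy. Let $\Omega$ be the set of probability measures $\mu$ on $\mathcal X$ with $D(w_{Z|X}\circ\mu\|q_0)<\infty$. For $\nu>0$ let $$A(\nu)=\sup\{I(\mu,w_{Y|X}) : \mu\in\Omega,\ D(w_{Z|X}\circ\mu\|q_0)\le\nu\},$$ and let $\mu^*_\nu\in\Omega$ denote an input law with $D(w_{Z|X}\circ\mu^*_\nu\|q_0)\le\nu$ and $I(\mu^*_\nu,w_{Y|X})=A(\nu)$. For $a>0$ let $\Omega_a(\nu)$ be the set of $\mu\in\Omega$ that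 are supported in $[0,a]$ and satisfy $D(w_{Z|X}\circ\mu\|q_0)\le\nu$, and let $\mathbb C_a[\mu]$ be the probability measure obtained from $\mu$ by moving all of its mass on $(a,\infty)$ to the point $a$, that is, the law of $\min(X,a)$ for $X\sim\mu$. Theorem. Let $(\nu_n)_{n\ge1}$ be a sequence of positive real numbers with $\nu_n\to0$, and let $a>1$. Then $\mathbb C_a[\mu^*_{\nu_n}]\in\Omega_a(\nu_n)$ for all sufficiently large $n$, and $$\liminf_{n\to\infty}\frac{I(\mu^*_{\nu_n},w_{Y|X})}{\sqrt{D(w_{Z|X}\circ\mu^*_{\nu_n}\|q_0)}}\ \le\ \liminf_{n\to\infty}\frac{I(\mathbb C_a[\mu^*_{\nu_n}],w_{Y|X})}{\sqrt{D(w_{Z|X}\circ\mathbb C_a[\mu^*_{\nu_n}]\|q_0)}} .$$ -/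

import Mathlib

open MeasureTheory ProbabilityTheory InformationTheory
open scoped ENNReal NNReal

namespace CovertRayleigh

noncomputable section

/-- The rate of the exponential output law of the non-coherent Rayleigh-fading channel with fading
parameter `θ` when the input is `x`; the mean of the output is `1 + θ ^ 2 * x`. -/
def rate (θ : ℝ) (x : ℝ≥0) : ℝ := 1 / (θ ^ 2 * x + 1)

lemma rate_pos (θ : ℝ) (x : ℝ≥0) : 0 < rate θ x := by
  unfold rate
  positivity

lemma measurable_expMeasure_rate (θ : ℝ) :
    Measurable (fun x : ℝ≥0 => expMeasure (rate θ x)) := by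
  refine Measure.measurable_of_measurable_coe _ fun s hs => ?_
  have h : ∀ x : ℝ≥0, expMeasure (rate θ x) s = ∫⁻ y in s, exponentialPDF (rate θ x) y :=
    fun x => withDensity_apply _ hs
  simp_rw [h, exponentialPDF_eq]
  refine Measurable.lintegral_prod_right'
    (f := fun p : ℝ≥0 × ℝ => ENNReal.ofReal
      (if 0 ≤ p.2 then rate θ p.1 * Real.exp (-(rate θ p.1 * p.2)) else 0)) ?_
  refine ENNReal.measurable_ofReal.comp (Measurable.ite ?_ ?_ measurable_const)
  · exact measurableSet_le measurable_const measurable_snd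
  · unfold rate
    fun_prop

/-- The normalized non-coherent Rayleigh-fading channel with parameter `θ`: on input `x ≥ 0` the
output has density `y ↦ (1 / (θ ^ 2 * x + 1)) * exp (- y / (θ ^ 2 * x + 1))` on `[0, ∞)`. -/
def fadingChannel (θ : ℝ) : Kernel ℝ≥0 ℝ where
  toFun x := expMeasure (rate θ x)
  measurable' := measurable_expMeasure_rate θ

instance (θ : ℝ) : IsMarkovKernel (fadingChannel θ) :=
  ⟨fun x => isProbabilityMeasure_expMeasure (rate_pos θ x)⟩

/-- The warden's channel: output density `z ↦ (1 / (x + 1)) * exp (- z / (x + 1))`. -/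
def wardenChannel : Kernel ℝ≥0 ℝ := fadingChannel 1

/-- The mutual information (in nats) between input and output of the channel `κ` when the input
has law `μ`: the relative entropy of the joint law with respect to the product of the marginals. -/
def mutualInfo (μ : Measure ℝ≥0) (κ : Kernel ℝ≥0 ℝ) : ℝ≥0∞ :=
  klDiv (μ ⊗ₘ κ) (μ.prod (κ ∘ₘ μ))

/-- The relative entropy of the warden's output law under the input law `μ` with respect to the
warden's output law under the zero input. -/
def wardenDiv (μ : Measure ℝ≥0) : ℝ≥0∞ :=
  klDiv (wardenChannel ∘ₘ μ) (wardenChannel 0)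

/-- The probability measures on `[0, ∞)` whose output at the warden has finite divergence. -/
def inputLaws : Set (Measure ℝ≥0) :=
  {μ | IsProbabilityMeasure μ ∧ wardenDiv μ < ∞}

/-- The input laws whose divergence at the warden is at most `ν`. -/
def feasible (ν : ℝ) : Set (Measure ℝ≥0) :=
  {μ | μ ∈ inputLaws ∧ wardenDiv μ ≤ ENNReal.ofReal ν}

/-- The input laws of amplitude at most `a` whose divergence at the warden is at most `ν`. -/
def feasibleAmp (a : ℝ≥0) (ν : ℝ) : Set (Measure ℝ≥0) :=
  {μ | μ ∈ feasible ν ∧ μ (Set.Ioi a) = 0}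

/-- The supremum of the mutual information over the main channel subject to the divergence
constraint `ν` at the warden. -/
def maxInfo (θ ν : ℝ) : ℝ≥0∞ :=
  ⨆ μ ∈ feasible ν, mutualInfo μ (fadingChannel θ)

/-- `μ` is an optimal input law for the divergence constraint `ν`. -/
def IsOptimal (θ ν : ℝ) (μ : Measure ℝ≥0) : Prop :=
  μ ∈ feasible ν ∧ mutualInfo μ (fadingChannel θ) = maxInfo θ ν

/-- Clipping at amplitude `a`: all the mass of `μ` on `(a, ∞)` is moved to the point `a`. -/
def clip (a : ℝ≥0) (μ : Measure ℝ≥0) : Measure ℝ≥0 :=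
  μ.map (fun x => min x a)

/-- Mutual information over the main channel divided by the square root of the divergence at the
warden. -/
def infoRatio (θ : ℝ) (μ : Measure ℝ≥0) : ℝ≥0∞ :=
  mutualInfo μ (fadingChannel θ) / wardenDiv μ ^ (1 / 2 : ℝ)

end

end CovertRayleigh

/-! Clipping lowers the warden's divergence and costs little information.

Divergence: a larger input stretches the output, and the log-density of any output law relative to
the zero-input output is increasing. So the mean of the clipped log-density under the clipped output
is at most its mean under the original output, which Gibbs' inequality bounds by the original
divergence (`outputDiv_clip_le`). This gives feasibility.

Information: I is the mean of `pointDiv` minus the divergence of the main output from its zero-input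
law (`mutualInfo_eq`). Clipping also lowers the subtracted term, so the loss is at most θ² times the
mean of the input above `a` (`mutualInfo_le_clip_add`).

Tail: if the warden's divergence is at most d ≤ 1, testing it against (z - T)⁺/2 with T = log(1/d)
bounds this mean by 6 d^(a/(a+1)) (`setLIntegral_Ioi_le`). Divided by √d, the bound tends to 0
exactly because a/(a+1) > 1/2 when a > 1. -/

namespace CovertRayleigh

/-! ### Moments, memorylessness and scaling of exponential laws. -/

section Exponential

lemma expMeasure_eq_withDensity (r : ℝ) :
    expMeasure r = volume.withDensity (exponentialPDF r) := rfl

@[fun_prop]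
lemma measurable_exponentialPDF (r : ℝ) : Measurable (exponentialPDF r) :=
  (measurable_exponentialPDFReal r).ennreal_ofReal

lemma lintegral_expMeasure (r : ℝ) {f : ℝ → ℝ≥0∞} (hf : Measurable f) :
    ∫⁻ y, f y ∂(expMeasure r) = ∫⁻ y, exponentialPDF r y * f y := by
  rw [expMeasure_eq_withDensity, lintegral_withDensity_eq_lintegral_mul _ (by fun_prop) hf]
  rfl

lemma ae_nonneg_expMeasure (r : ℝ) : ∀ᵐ y ∂(expMeasure r), 0 ≤ y := by
  rw [expMeasure_eq_withDensity, ae_withDensity_iff (by fun_prop)]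
  refine ae_of_all _ fun y hy => ?_
  by_contra h
  exact hy (exponentialPDF_of_neg (not_le.mp h))

lemma lintegral_id_expMeasure {r : ℝ} (hr : 0 < r) :
    ∫⁻ y, ENNReal.ofReal y ∂(expMeasure r) = ENNReal.ofReal (1 / r) := by
  -- Weighting the exponential density by `y` gives a multiple of the Gamma(2, r) density, whose
  -- total mass is known.
  have h : ∀ y, exponentialPDF r y * ENNReal.ofReal y
      = ENNReal.ofReal (1 / r) * gammaPDF 2 r y := by
    intro y
    rcases lt_or_ge y 0 with hy | hy
    · rw [exponentialPDF_of_neg hy, gammaPDF_of_neg hy, zero_mul, mul_zero]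
    · rw [exponentialPDF_of_nonneg hy, gammaPDF_of_nonneg hy, ← ENNReal.ofReal_mul (by positivity),
        ← ENNReal.ofReal_mul (by positivity)]
      congr 1
      have h1 : y ^ ((2 : ℝ) - 1) = y := by norm_num
      have h2 : r ^ (2 : ℝ) = r ^ 2 := by norm_num
      rw [h1, h2, Real.Gamma_two]
      field_simp
  rw [lintegral_expMeasure r (by fun_prop)]
  simp_rw [h]
  rw [lintegral_const_mul' _ _ ENNReal.ofReal_ne_top, lintegral_gammaPDF_eq_one two_pos hr, mul_one]

lemma integrable_id_expMeasure {r : ℝ} (hr : 0 < r) :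
    Integrable (fun y => y) (expMeasure r) := by
  refine ⟨by fun_prop, ?_⟩
  rw [hasFiniteIntegral_iff_ofReal (ae_nonneg_expMeasure r), lintegral_id_expMeasure hr]
  exact ENNReal.ofReal_lt_top

lemma integral_id_expMeasure {r : ℝ} (hr : 0 < r) :
    ∫ y, y ∂(expMeasure r) = 1 / r := by
  rw [integral_eq_lintegral_of_nonneg_ae (ae_nonneg_expMeasure r) (by fun_prop),
    lintegral_id_expMeasure hr, ENNReal.toReal_ofReal (by positivity)]

/-- Memorylessness of the exponential law. -/
lemma lintegral_expMeasure_shift (r : ℝ) {T : ℝ} (hT : 0 ≤ T) {f : ℝ → ℝ≥0∞}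
    (hf : Measurable f) (hf0 : ∀ y < 0, f y = 0) :
    ∫⁻ y, f (y - T) ∂(expMeasure r)
      = ENNReal.ofReal (Real.exp (-(r * T))) * ∫⁻ y, f y ∂(expMeasure r) := by
  rw [lintegral_expMeasure r (by fun_prop), lintegral_expMeasure r hf,
    ← lintegral_const_mul' _ _ ENNReal.ofReal_ne_top,
    ← lintegral_add_right_eq_self _ T]
  refine lintegral_congr fun y => ?_
  rw [add_sub_cancel_right]
  rcases lt_or_ge y 0 with hy | hy
  · simp [hf0 y hy]
  · rw [← mul_assoc]
    congr 1
    rw [exponentialPDF_of_nonneg hy, exponentialPDF_of_nonneg (by positivity),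
      ← ENNReal.ofReal_mul (by positivity), mul_left_comm, ← Real.exp_add]
    ring_nf

lemma lintegral_exp_half_expMeasure_one :
    ∫⁻ y, ENNReal.ofReal (Real.exp (y / 2)) ∂(expMeasure 1) = 2 := by
  have h : ∀ y, exponentialPDF 1 y * ENNReal.ofReal (Real.exp (y / 2))
      = 2 * exponentialPDF (1 / 2) y := by
    intro y
    rcases lt_or_ge y 0 with hy | hy
    · rw [exponentialPDF_of_neg hy, exponentialPDF_of_neg hy, zero_mul, mul_zero]
    · rw [exponentialPDF_of_nonneg hy, exponentialPDF_of_nonneg hy,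
        ← ENNReal.ofReal_mul (by positivity), ← ENNReal.ofReal_ofNat,
        ← ENNReal.ofReal_mul (by positivity), one_mul, ← Real.exp_add, ← mul_assoc,
        mul_one_div_cancel two_ne_zero, one_mul]
      ring_nf
  rw [lintegral_expMeasure 1 (by fun_prop)]
  simp_rw [h]
  rw [lintegral_const_mul' _ _ (by simp), lintegral_exponentialPDF_eq_one (by norm_num), mul_one]

/-- An exponential law of rate `r` is a rescaled standard exponential law. -/
lemma map_expMeasure_one {r : ℝ} (hr : 0 < r) :
    (expMeasure 1).map (fun z => z / r) = expMeasure r := by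
  have : IsProbabilityMeasure (expMeasure 1) := isProbabilityMeasure_expMeasure one_pos
  have : IsProbabilityMeasure (expMeasure r) := isProbabilityMeasure_expMeasure hr
  have hm : Measurable fun z : ℝ => z / r := by fun_prop
  have : IsProbabilityMeasure ((expMeasure 1).map fun z => z / r) :=
    Measure.isProbabilityMeasure_map hm.aemeasurable
  refine Measure.eq_of_cdf _ _ ?_
  ext x
  rw [cdf_eq_real, map_measureReal_apply hm measurableSet_Iic]
  have h : (fun z : ℝ => z / r) ⁻¹' Set.Iic x = Set.Iic (r * x) := by
    ext z
    simp [div_le_iff₀ hr, mul_comm]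
  rw [h, ← cdf_eq_real, cdf_expMeasure_eq one_pos, cdf_expMeasure_eq hr]
  simp only [one_mul, mul_nonneg_iff_of_pos_left hr]

end Exponential

/-! ### Relative entropy: variational bound and density formulas. -/

section RelativeEntropy

variable {α : Type*} {mα : MeasurableSpace α}

/-- A variational lower bound for the relative entropy. -/
lemma lintegral_le_klDiv_add (P Q : Measure α) [IsFiniteMeasure P] [IsFiniteMeasure Q]
    {g : α → ℝ} (hg : Measurable g) (hg0 : ∀ y, 0 ≤ g y) :
    ∫⁻ y, ENNReal.ofReal (g y) ∂P
      ≤ klDiv P Q + ∫⁻ y, ENNReal.ofReal (Real.exp (g y) - 1) ∂Q := by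
  by_cases hac : P ≪ Q
  swap
  · simp [klDiv_of_not_ac hac]
  rw [klDiv_eq_lintegral_klFun_of_ac hac, ← lintegral_add_left (by fun_prop),
    ← lintegral_rnDeriv_mul hac (by fun_prop)]
  refine lintegral_mono_ae ?_
  filter_upwards [P.rnDeriv_ne_top Q] with y hy
  set r := (P.rnDeriv Q y).toReal with hr
  have hr0 : 0 ≤ r := ENNReal.toReal_nonneg
  rw [← ENNReal.ofReal_toReal hy, ← hr, ← ENNReal.ofReal_mul hr0,
    ← ENNReal.ofReal_add (klFun_nonneg hr0) (by simpa using hg0 y)]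
  refine ENNReal.ofReal_le_ofReal ?_
  rw [klFun_apply]
  rcases hr0.eq_or_lt with h0 | hpos
  · simp [← h0, Real.exp_nonneg]
  -- Fenchel–Young: r g ≤ (r log r - r + 1) + (e^g - 1), from t + 1 ≤ e^t at t = g - log r. Being
  -- pointwise, it integrates without any integrability assumption.
  · have h1 := Real.add_one_le_exp (g y - Real.log r)
    rw [Real.exp_sub, Real.exp_log hpos, le_div_iff₀ hpos] at h1
    linarith

variable {P Q : Measure α} {f : α → ℝ}

lemma withDensity_div_of_eq_withDensity {R : Measure α} {p q : α → ℝ} (hp : Measurable p)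
    (hq : Measurable q) (hq0 : ∀ y, 0 < q y)
    (hP : P = R.withDensity fun y => ENNReal.ofReal (p y))
    (hQ : Q = R.withDensity fun y => ENNReal.ofReal (q y)) :
    P = Q.withDensity fun y => ENNReal.ofReal (p y / q y) := by
  rw [hP, hQ, ← withDensity_mul _ (by fun_prop) (by fun_prop)]
  congr 1
  ext y
  rw [Pi.mul_apply, ← ENNReal.ofReal_mul (hq0 y).le, mul_div_cancel₀ _ (hq0 y).ne']

variable [IsProbabilityMeasure Q]

lemma llr_ae_eq_of_eq_withDensity (hf : Measurable f) (hf0 : ∀ y, 0 < f y)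
    (h : P = Q.withDensity fun y => ENNReal.ofReal (f y)) :
    llr P Q =ᵐ[P] fun y => Real.log (f y) := by
  have hac : P ≪ Q := h ▸ withDensity_absolutelyContinuous _ _
  have hd := Measure.rnDeriv_withDensity Q hf.ennreal_ofReal
  rw [← h] at hd
  filter_upwards [hac.ae_le hd] with y hy
  rw [llr, hy, ENNReal.toReal_ofReal (hf0 y).le]

variable [IsProbabilityMeasure P]

lemma toReal_klDiv_of_eq_withDensity (hf : Measurable f) (hf0 : ∀ y, 0 < f y)
    (h : P = Q.withDensity fun y => ENNReal.ofReal (f y)) :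
    (klDiv P Q).toReal = ∫ y, Real.log (f y) ∂P := by
  rw [toReal_klDiv_of_measure_eq (h ▸ withDensity_absolutelyContinuous _ _) (by simp)]
  exact integral_congr_ae (llr_ae_eq_of_eq_withDensity hf hf0 h)

lemma klDiv_of_eq_withDensity (hf : Measurable f) (hf0 : ∀ y, 0 < f y)
    (h : P = Q.withDensity fun y => ENNReal.ofReal (f y))
    (hi : Integrable (fun y => Real.log (f y)) P) :
    klDiv P Q = ENNReal.ofReal (∫ y, Real.log (f y) ∂P) := by
  rw [← toReal_klDiv_of_eq_withDensity hf hf0 h, ENNReal.ofReal_toReal]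
  exact klDiv_ne_top (h ▸ withDensity_absolutelyContinuous _ _)
    (hi.congr (llr_ae_eq_of_eq_withDensity hf hf0 h).symm)

end RelativeEntropy

end CovertRayleigh

namespace CovertRayleigh

noncomputable section

/-! ### Likelihood ratios against the zero-input output. -/

section Likelihood

variable (θ : ℝ)

/-- The density of the output law on input `x` with respect to the output law on input `0`. -/
def likelihood (x : ℝ≥0) (y : ℝ) : ℝ := rate θ x * Real.exp ((1 - rate θ x) * y)

/-- The density of the output law under the input law `μ` with respect to the output law on
input `0`. -/
def outputDensity (μ : Measure ℝ≥0) (y : ℝ) : ℝ := ∫ x, likelihood θ x y ∂μ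

lemma fadingChannel_apply (x : ℝ≥0) : fadingChannel θ x = expMeasure (rate θ x) := rfl

lemma rate_zero : rate θ 0 = 1 := by simp [rate]

lemma rate_le_one (x : ℝ≥0) : rate θ x ≤ 1 := by
  unfold rate
  rw [div_le_one (by positivity)]
  have : 0 ≤ θ ^ 2 * (x : ℝ) := by positivity
  linarith

lemma one_div_rate (x : ℝ≥0) : 1 / rate θ x = θ ^ 2 * x + 1 := by
  rw [rate, one_div_one_div]

@[fun_prop]
lemma measurable_rate : Measurable (rate θ) := by
  unfold rate
  fun_prop

lemma rate_antitone : Antitone (rate θ) := by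
  intro x y hxy
  unfold rate
  gcongr

lemma likelihood_pos (x : ℝ≥0) (y : ℝ) : 0 < likelihood θ x y :=
  mul_pos (rate_pos θ x) (Real.exp_pos _)

lemma log_likelihood (x : ℝ≥0) (y : ℝ) :
    Real.log (likelihood θ x y) = Real.log (rate θ x) + (1 - rate θ x) * y := by
  rw [likelihood, Real.log_mul (rate_pos θ x).ne' (Real.exp_pos _).ne', Real.log_exp]

/-- The bound is uniform in the input, so output densities are finite for every input law, with no
moment condition. -/
lemma likelihood_le (x : ℝ≥0) (y : ℝ) : likelihood θ x y ≤ Real.exp |y| := by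
  rw [← one_mul (Real.exp |y|), likelihood]
  have h0 := (rate_pos θ x).le
  have h1 := rate_le_one θ x
  refine mul_le_mul h1 (Real.exp_le_exp.mpr ?_) (Real.exp_pos _).le zero_le_one
  calc (1 - rate θ x) * y ≤ (1 - rate θ x) * |y| := by
        exact mul_le_mul_of_nonneg_left (le_abs_self y) (by linarith)
    _ ≤ 1 * |y| := by gcongr; linarith
    _ = |y| := one_mul _

lemma rate_le_likelihood (x : ℝ≥0) {y : ℝ} (hy : 0 ≤ y) : rate θ x ≤ likelihood θ x y := by
  refine le_mul_of_one_le_right (rate_pos θ x).le (Real.one_le_exp ?_)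
  exact mul_nonneg (by linarith [rate_le_one θ x]) hy

lemma likelihood_mono (x : ℝ≥0) : Monotone (likelihood θ x) := by
  intro y z hyz
  have := rate_le_one θ x
  have := (rate_pos θ x).le
  unfold likelihood
  gcongr

@[fun_prop]
lemma measurable_likelihood : Measurable fun p : ℝ≥0 × ℝ => likelihood θ p.1 p.2 := by
  unfold likelihood
  fun_prop

lemma fadingChannel_eq_withDensity (x : ℝ≥0) :
    fadingChannel θ x
      = (fadingChannel θ 0).withDensity fun y => ENNReal.ofReal (likelihood θ x y) := by
  have hm : Measurable fun y => ENNReal.ofReal (likelihood θ x y) :=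
    ((measurable_likelihood θ).comp (measurable_prodMk_left (x := x))).ennreal_ofReal
  rw [fadingChannel_apply, fadingChannel_apply, expMeasure_eq_withDensity,
    expMeasure_eq_withDensity, ← withDensity_mul _ (by fun_prop) hm]
  congr 1
  ext y
  rw [Pi.mul_apply, rate_zero]
  rcases lt_or_ge y 0 with hy | hy
  · rw [exponentialPDF_of_neg hy, exponentialPDF_of_neg hy, zero_mul]
  · rw [exponentialPDF_of_nonneg hy, exponentialPDF_of_nonneg hy,
      ← ENNReal.ofReal_mul (by positivity), likelihood, one_mul, one_mul, mul_left_comm,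
      ← Real.exp_add]
    ring_nf

lemma ae_nonneg_output (μ : Measure ℝ≥0) : ∀ᵐ y ∂(fadingChannel θ ∘ₘ μ), 0 ≤ y :=
  Measure.ae_comp_of_ae_ae measurableSet_Ici (ae_of_all _ fun _ => ae_nonneg_expMeasure _)

variable (μ : Measure ℝ≥0)

lemma measurable_outputDensity [SFinite μ] : Measurable (outputDensity θ μ) := by
  have h : StronglyMeasurable (Function.uncurry fun (y : ℝ) (x : ℝ≥0) => likelihood θ x y) :=
    ((measurable_likelihood θ).comp measurable_swap).stronglyMeasurable
  exact h.integral_prod_right.measurable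

variable [IsProbabilityMeasure μ]

lemma integrable_likelihood (y : ℝ) : Integrable (fun x => likelihood θ x y) μ := by
  refine (integrable_const (Real.exp |y|)).mono' (by fun_prop) (ae_of_all _ fun x => ?_)
  rw [Real.norm_of_nonneg (likelihood_pos θ x y).le]
  exact likelihood_le θ x y

lemma integrable_rate : Integrable (rate θ) μ := by
  refine (integrable_const (1 : ℝ)).mono' (by fun_prop) (ae_of_all _ fun x => ?_)
  rw [Real.norm_of_nonneg (rate_pos θ x).le]
  exact rate_le_one θ x

lemma outputDensity_pos (y : ℝ) : 0 < outputDensity θ μ y := by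
  have h : ∀ x, likelihood θ x y = Real.exp (Real.log (likelihood θ x y)) := fun x =>
    (Real.exp_log (likelihood_pos θ x y)).symm
  rw [outputDensity, integral_congr_ae (ae_of_all μ h)]
  exact integral_exp_pos ((integrable_likelihood θ μ y).congr (ae_of_all μ h))

lemma integral_rate_pos : 0 < ∫ x, rate θ x ∂μ := by
  have h := outputDensity_pos θ μ 0
  simpa [outputDensity, likelihood] using h

lemma outputDensity_mono : Monotone (outputDensity θ μ) := fun y z hyz =>
  integral_mono (integrable_likelihood θ μ y) (integrable_likelihood θ μ z)
    fun x => likelihood_mono θ x hyz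

lemma log_outputDensity_mono : Monotone fun y => Real.log (outputDensity θ μ y) :=
  fun _ _ hyz => Real.log_le_log (outputDensity_pos θ μ _) (outputDensity_mono θ μ hyz)

/-- Linear growth in `y` makes the log-density integrable under any output law of finite mean,
including one produced by a different input law, as Gibbs' inequality and the clipping argument
require. -/
lemma abs_log_outputDensity_le {y : ℝ} (hy : 0 ≤ y) :
    |Real.log (outputDensity θ μ y)| ≤ |Real.log (∫ x, rate θ x ∂μ)| + y := by
  have h1 : Real.log (∫ x, rate θ x ∂μ) ≤ Real.log (outputDensity θ μ y) :=
    Real.log_le_log (integral_rate_pos θ μ) (integral_mono (integrable_rate θ μ)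
      (integrable_likelihood θ μ y) fun x => rate_le_likelihood θ x hy)
  have h2 : Real.log (outputDensity θ μ y) ≤ y := by
    rw [Real.log_le_iff_le_exp (outputDensity_pos θ μ y)]
    have := integral_mono (integrable_likelihood θ μ y)
      (integrable_const (Real.exp |y|)) fun x => likelihood_le θ x y
    simpa [abs_of_nonneg hy, outputDensity] using this
  rw [abs_le]
  have h3 := neg_abs_le (Real.log (∫ x, rate θ x ∂μ))
  have h4 := abs_nonneg (Real.log (∫ x, rate θ x ∂μ))
  constructor <;> linarith

lemma output_eq_withDensity :
    fadingChannel θ ∘ₘ μ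
      = (fadingChannel θ 0).withDensity fun y => ENNReal.ofReal (outputDensity θ μ y) := by
  have hm : Measurable fun p : ℝ≥0 × ℝ => ENNReal.ofReal (likelihood θ p.1 p.2) := by fun_prop
  ext s hs
  rw [Measure.bind_apply hs (fadingChannel θ).aemeasurable, withDensity_apply _ hs]
  have h : ∀ x, fadingChannel θ x s
      = ∫⁻ y in s, ENNReal.ofReal (likelihood θ x y) ∂(fadingChannel θ 0) := fun x => by
    rw [fadingChannel_eq_withDensity θ x, withDensity_apply _ hs]
  simp_rw [h]
  rw [lintegral_lintegral_swap hm.aemeasurable]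
  refine lintegral_congr fun y => ?_
  rw [outputDensity, ofReal_integral_eq_lintegral_ofReal (integrable_likelihood θ μ y)
    (ae_of_all _ fun x => (likelihood_pos θ x y).le)]

lemma joint_eq_withDensity :
    μ ⊗ₘ fadingChannel θ = (μ.prod (fadingChannel θ ∘ₘ μ)).withDensity
      fun p => ENNReal.ofReal (likelihood θ p.1 p.2 / outputDensity θ μ p.2) := by
  have hd := measurable_outputDensity θ μ
  have hm : Measurable fun p : ℝ≥0 × ℝ =>
      ENNReal.ofReal (likelihood θ p.1 p.2 / outputDensity θ μ p.2) := by fun_prop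
  ext s hs
  rw [Measure.compProd_apply hs, withDensity_apply _ hs, ← lintegral_indicator hs,
    lintegral_prod _ (hm.indicator hs).aemeasurable]
  refine lintegral_congr fun x => ?_
  have h := withDensity_div_of_eq_withDensity (p := likelihood θ x) (by fun_prop) hd
    (outputDensity_pos θ μ) (fadingChannel_eq_withDensity θ x) (output_eq_withDensity θ μ)
  rw [h, withDensity_apply _ (measurable_prodMk_left hs),
    ← lintegral_indicator (measurable_prodMk_left hs)]
  rfl

end Likelihood

/-! ### Integrability and output expectations under a finite input mean. -/

section Integrability

variable (θ : ℝ)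

lemma lintegral_id_output (μ : Measure ℝ≥0) :
    ∫⁻ y, ENNReal.ofReal y ∂(fadingChannel θ ∘ₘ μ)
      = ∫⁻ x : ℝ≥0, ENNReal.ofReal (θ ^ 2 * x + 1) ∂μ := by
  rw [Measure.lintegral_bind (fadingChannel θ).aemeasurable (by fun_prop)]
  refine lintegral_congr fun x => ?_
  rw [fadingChannel_apply, lintegral_id_expMeasure (rate_pos θ x), one_div_rate]

variable {μ : Measure ℝ≥0} [IsProbabilityMeasure μ]

lemma integrable_id_output (hμ : Integrable (fun x : ℝ≥0 => (x : ℝ)) μ) :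
    Integrable (fun y => y) (fadingChannel θ ∘ₘ μ) := by
  refine ⟨by fun_prop, ?_⟩
  rw [hasFiniteIntegral_iff_ofReal (ae_nonneg_output θ μ), lintegral_id_output,
    ← hasFiniteIntegral_iff_ofReal (ae_of_all _ fun x => by positivity)]
  exact ((hμ.const_mul (θ ^ 2)).add (integrable_const 1)).2

lemma integrable_log_outputDensity (π : Measure ℝ≥0) [IsProbabilityMeasure π]
    (hμ : Integrable (fun x : ℝ≥0 => (x : ℝ)) μ) :
    Integrable (fun y => Real.log (outputDensity θ π y)) (fadingChannel θ ∘ₘ μ) := by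
  refine ((integrable_const |Real.log (∫ x, rate θ x ∂π)|).add
    (integrable_id_output θ hμ)).mono'
    (measurable_outputDensity θ π).log.aestronglyMeasurable ?_
  filter_upwards [ae_nonneg_output θ μ] with y hy
  exact abs_log_outputDensity_le θ π hy

lemma integrable_log_outputDensity_fadingChannel (π : Measure ℝ≥0) [IsProbabilityMeasure π]
    (x : ℝ≥0) :
    Integrable (fun y => Real.log (outputDensity θ π y)) (fadingChannel θ x) := by
  have hi : Integrable (fun y => y) (fadingChannel θ x) := integrable_id_expMeasure (rate_pos θ x)
  refine ((integrable_const |Real.log (∫ x, rate θ x ∂π)|).add hi).mono'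
    (measurable_outputDensity θ π).log.aestronglyMeasurable ?_
  filter_upwards [ae_nonneg_expMeasure (rate θ x)] with y hy
  exact abs_log_outputDensity_le θ π hy

lemma abs_log_rate_le (x : ℝ≥0) : |Real.log (rate θ x)| ≤ θ ^ 2 * x := by
  rw [rate, one_div, Real.log_inv, abs_neg, abs_of_nonneg (Real.log_nonneg _)]
  · have := Real.log_le_sub_one_of_pos (show 0 < θ ^ 2 * (x : ℝ) + 1 by positivity)
    linarith
  · have : 0 ≤ θ ^ 2 * (x : ℝ) := by positivity
    linarith

lemma integral_output {f : ℝ → ℝ} (hf : Integrable f (fadingChannel θ ∘ₘ μ)) :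
    ∫ y, f y ∂(fadingChannel θ ∘ₘ μ) = ∫ x, ∫ y, f y ∂(fadingChannel θ x) ∂μ := by
  have h := (Measure.integrable_compProd_snd_iff hf.1).mpr hf
  rw [← Measure.integral_compProd (f := fun p => f p.2) h, ← Measure.snd_compProd, Measure.snd,
    integral_map measurable_snd.aemeasurable]
  rw [← Measure.snd, Measure.snd_compProd]
  exact hf.1

lemma integrable_log_likelihood (hμ : Integrable (fun x : ℝ≥0 => (x : ℝ)) μ) :
    Integrable (fun p : ℝ≥0 × ℝ => Real.log (likelihood θ p.1 p.2)) (μ ⊗ₘ fadingChannel θ) := by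
  have h2 : Integrable (fun p : ℝ≥0 × ℝ => p.2) (μ ⊗ₘ fadingChannel θ) :=
    (Measure.integrable_compProd_snd_iff (f := fun y => y) (by fun_prop)).mpr
      (integrable_id_output θ hμ)
  have h1 : Integrable (fun p : ℝ≥0 × ℝ => θ ^ 2 * (p.1 : ℝ)) (μ ⊗ₘ fadingChannel θ) := by
    have h : Integrable (fun x : ℝ≥0 => θ ^ 2 * (x : ℝ)) (μ ⊗ₘ fadingChannel θ).fst := by
      rw [Measure.fst_compProd]
      exact hμ.const_mul _
    exact h.comp_measurable measurable_fst
  refine (h1.add h2.norm).mono' (measurable_likelihood θ).log.aestronglyMeasurable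
    (ae_of_all _ fun p => ?_)
  rw [log_likelihood]
  refine (norm_add_le _ _).trans (add_le_add (abs_log_rate_le θ p.1) ?_)
  rw [norm_mul]
  refine mul_le_of_le_one_left (norm_nonneg _) ?_
  have := rate_pos θ p.1
  have := rate_le_one θ p.1
  rw [Real.norm_of_nonneg (by linarith)]
  linarith

/-- The relative entropy of the output law on input `x` with respect to that on input `0`. -/
def pointDiv (x : ℝ≥0) : ℝ := θ ^ 2 * x - Real.log (θ ^ 2 * x + 1)

lemma integral_log_likelihood_fadingChannel (x : ℝ≥0) :
    ∫ y, Real.log (likelihood θ x y) ∂(fadingChannel θ x) = pointDiv θ x := by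
  simp_rw [log_likelihood]
  have hr := rate_pos θ x
  have h : Integrable (fun y => (1 - rate θ x) * y) (fadingChannel θ x) :=
    (integrable_id_expMeasure hr).const_mul (1 - rate θ x)
  have hlog : Real.log (rate θ x) = -Real.log (θ ^ 2 * x + 1) := by
    rw [rate, one_div, Real.log_inv]
  rw [integral_add (integrable_const _) h, integral_const_mul, integral_const, probReal_univ,
    fadingChannel_apply, integral_id_expMeasure hr, sub_mul, mul_one_div_cancel hr.ne',
    one_div_rate, hlog, pointDiv]
  simp
  ring

lemma integrable_pointDiv {π : Measure ℝ≥0} (hπ : Integrable (fun x : ℝ≥0 => (x : ℝ)) π) :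
    Integrable (pointDiv θ) π := by
  have hm : Measurable (pointDiv θ) := by
    unfold pointDiv
    fun_prop
  refine (hπ.const_mul (θ ^ 2)).mono' hm.aestronglyMeasurable (ae_of_all _ fun x => ?_)
  have h0 : 0 ≤ θ ^ 2 * (x : ℝ) := by positivity
  have h1 := Real.log_le_sub_one_of_pos (show 0 < θ ^ 2 * (x : ℝ) + 1 by positivity)
  have h2 := Real.log_nonneg (show 1 ≤ θ ^ 2 * (x : ℝ) + 1 by linarith)
  rw [pointDiv, Real.norm_of_nonneg (by linarith)]
  linarith

lemma integral_log_likelihood (hμ : Integrable (fun x : ℝ≥0 => (x : ℝ)) μ) :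
    ∫ p : ℝ≥0 × ℝ, Real.log (likelihood θ p.1 p.2) ∂(μ ⊗ₘ fadingChannel θ)
      = ∫ x, pointDiv θ x ∂μ := by
  rw [Measure.integral_compProd (integrable_log_likelihood θ hμ)]
  simp_rw [integral_log_likelihood_fadingChannel]

end Integrability

end

end CovertRayleigh

namespace CovertRayleigh

noncomputable section

/-! ### Formulas for divergence and information; Gibbs' inequality and stochastic order. -/

section Formulas

variable (θ : ℝ) {μ : Measure ℝ≥0} [IsProbabilityMeasure μ]

/-- The relative entropy of the output law under `μ` with respect to the output law on input
`0`. -/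
def outputDiv (μ : Measure ℝ≥0) : ℝ :=
  ∫ y, Real.log (outputDensity θ μ y) ∂(fadingChannel θ ∘ₘ μ)

lemma klDiv_output (hμ : Integrable (fun x : ℝ≥0 => (x : ℝ)) μ) :
    klDiv (fadingChannel θ ∘ₘ μ) (fadingChannel θ 0) = ENNReal.ofReal (outputDiv θ μ) :=
  klDiv_of_eq_withDensity (measurable_outputDensity θ μ) (outputDensity_pos θ μ)
    (output_eq_withDensity θ μ) (integrable_log_outputDensity θ μ hμ)

/-- The log-density of the joint law against the product splits as log-likelihood minus log output
density. Finite input mean makes both terms integrable, so they may be integrated separately. -/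
lemma mutualInfo_eq (hμ : Integrable (fun x : ℝ≥0 => (x : ℝ)) μ) :
    mutualInfo μ (fadingChannel θ) = ENNReal.ofReal (∫ x, pointDiv θ x ∂μ - outputDiv θ μ) := by
  have hd := measurable_outputDensity θ μ
  have hlog : ∀ p : ℝ≥0 × ℝ, Real.log (likelihood θ p.1 p.2 / outputDensity θ μ p.2)
      = Real.log (likelihood θ p.1 p.2) - Real.log (outputDensity θ μ p.2) := fun p =>
    Real.log_div (likelihood_pos θ _ _).ne' (outputDensity_pos θ μ _).ne'
  have hi := integrable_log_outputDensity θ μ hμ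
  have hi2 : Integrable (fun p : ℝ≥0 × ℝ => Real.log (outputDensity θ μ p.2))
      (μ ⊗ₘ fadingChannel θ) :=
    (Measure.integrable_compProd_snd_iff
      (f := fun y => Real.log (outputDensity θ μ y)) hi.1).mpr hi
  have h2 : ∫ p : ℝ≥0 × ℝ, Real.log (outputDensity θ μ p.2) ∂(μ ⊗ₘ fadingChannel θ)
      = outputDiv θ μ := by
    rw [outputDiv, integral_output θ hi, Measure.integral_compProd hi2]
  rw [mutualInfo, klDiv_of_eq_withDensity (by fun_prop)
    (fun p => div_pos (likelihood_pos θ _ _) (outputDensity_pos θ μ _)) (joint_eq_withDensity θ μ)]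
  · simp_rw [hlog]
    rw [integral_sub (integrable_log_likelihood θ hμ) hi2, h2, integral_log_likelihood θ hμ]
  · simp_rw [hlog]
    exact (integrable_log_likelihood θ hμ).sub hi2

/-- Gibbs' inequality for output laws. -/
lemma integral_log_outputDensity_le (π : Measure ℝ≥0) [IsProbabilityMeasure π]
    (hμ : Integrable (fun x : ℝ≥0 => (x : ℝ)) μ) :
    ∫ y, Real.log (outputDensity θ π y) ∂(fadingChannel θ ∘ₘ μ) ≤ outputDiv θ μ := by
  have hdμ := measurable_outputDensity θ μ
  have hdπ := measurable_outputDensity θ π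
  have h := toReal_klDiv_of_eq_withDensity (hdμ.div hdπ)
    (fun y => div_pos (outputDensity_pos θ μ y) (outputDensity_pos θ π y))
    (withDensity_div_of_eq_withDensity hdμ hdπ (outputDensity_pos θ π)
      (output_eq_withDensity θ μ) (output_eq_withDensity θ π))
  have hlog : ∀ y, Real.log ((outputDensity θ μ / outputDensity θ π) y)
      = Real.log (outputDensity θ μ y) - Real.log (outputDensity θ π y) := fun y =>
    Real.log_div (outputDensity_pos θ μ y).ne' (outputDensity_pos θ π y).ne'
  simp_rw [hlog] at h
  rw [integral_sub (integrable_log_outputDensity θ μ hμ)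
    (integrable_log_outputDensity θ π hμ)] at h
  have h0 : 0 ≤ (klDiv (fadingChannel θ ∘ₘ μ) (fadingChannel θ ∘ₘ π)).toReal :=
    ENNReal.toReal_nonneg
  rw [outputDiv]
  linarith

/-- Larger inputs give stochastically larger outputs. -/
lemma integral_log_outputDensity_fadingChannel_mono (π : Measure ℝ≥0) [IsProbabilityMeasure π] :
    Monotone fun x => ∫ y, Real.log (outputDensity θ π y) ∂(fadingChannel θ x) := by
  have hm := (measurable_outputDensity θ π).log
  have hdiv : ∀ x : ℝ≥0, Measurable fun z : ℝ => z / rate θ x := fun x => by fun_prop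
  -- Coupling: every output is one standard exponential variable multiplied by θ²x + 1, so outputs
  -- for different inputs compare pointwise.
  have hmap : ∀ x, fadingChannel θ x = (expMeasure 1).map fun z => z / rate θ x := fun x =>
    (map_expMeasure_one (rate_pos θ x)).symm
  have heq : ∀ x, ∫ y, Real.log (outputDensity θ π y) ∂(fadingChannel θ x)
      = ∫ z, Real.log (outputDensity θ π (z / rate θ x)) ∂(expMeasure 1) := fun x => by
    rw [hmap, integral_map (hdiv x).aemeasurable hm.aestronglyMeasurable]
  have hint : ∀ x, Integrable (fun z => Real.log (outputDensity θ π (z / rate θ x)))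
      (expMeasure 1) := fun x => by
    have h := integrable_log_outputDensity_fadingChannel θ π x
    rw [hmap] at h
    exact h.comp_measurable (hdiv x)
  intro x x' hx
  simp only [heq]
  refine integral_mono_ae (hint x) (hint x') ?_
  filter_upwards [ae_nonneg_expMeasure 1] with z hz
  exact log_outputDensity_mono θ π
    (div_le_div_of_nonneg_left hz (rate_pos θ x') (rate_antitone θ hx))

end Formulas

/-! ### Effect of clipping on divergence and information. -/

section Clip

variable (θ : ℝ) (a : ℝ≥0) {μ : Measure ℝ≥0}

lemma measurable_min_const : Measurable fun x : ℝ≥0 => min x a := by fun_prop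

instance isProbabilityMeasure_clip [IsProbabilityMeasure μ] : IsProbabilityMeasure (clip a μ) :=
  Measure.isProbabilityMeasure_map (measurable_min_const a).aemeasurable

lemma clip_Ioi : clip a μ (Set.Ioi a) = 0 := by
  rw [clip, Measure.map_apply (measurable_min_const a) measurableSet_Ioi]
  convert measure_empty (μ := μ)
  ext x
  simp

lemma integral_clip {f : ℝ≥0 → ℝ} (hf : AEStronglyMeasurable f (clip a μ)) :
    ∫ x, f x ∂(clip a μ) = ∫ x, f (min x a) ∂μ :=
  integral_map (measurable_min_const a).aemeasurable hf

lemma integrable_clip [IsProbabilityMeasure μ] :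
    Integrable (fun x : ℝ≥0 => (x : ℝ)) (clip a μ) := by
  refine (integrable_const (a : ℝ)).mono' (by fun_prop) ?_
  refine (ae_map_iff (measurable_min_const a).aemeasurable ?_).mpr (ae_of_all _ fun x => ?_)
  · exact measurableSet_le (by fun_prop) measurable_const
  · rw [Real.norm_of_nonneg (NNReal.coe_nonneg _)]
    exact_mod_cast min_le_right x a

variable [IsProbabilityMeasure μ]

/-- Clipping the input decreases the relative entropy at the output. -/
lemma outputDiv_clip_le (hμ : Integrable (fun x : ℝ≥0 => (x : ℝ)) μ) :
    outputDiv θ (clip a μ) ≤ outputDiv θ μ := by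
  -- The intermediate quantity is the mean of the clipped law's log-density under the unclipped
  -- output: Gibbs bounds it above, monotonicity in the input bounds it below.
  refine le_trans ?_ (integral_log_outputDensity_le θ (clip a μ) hμ)
  have hi := integrable_log_outputDensity θ (clip a μ) hμ
  have hi' := integrable_log_outputDensity θ (clip a μ) (integrable_clip a (μ := μ))
  have hmono := integral_log_outputDensity_fadingChannel_mono θ (clip a μ)
  have hj : Integrable (fun x => ∫ y, Real.log (outputDensity θ (clip a μ) y)
      ∂(fadingChannel θ x)) μ :=
    ((Measure.integrable_compProd_snd_iff hi.1).mpr hi).integral_compProd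
  have hj' : Integrable (fun x => ∫ y, Real.log (outputDensity θ (clip a μ) y)
      ∂(fadingChannel θ x)) (clip a μ) :=
    ((Measure.integrable_compProd_snd_iff hi'.1).mpr hi').integral_compProd
  rw [outputDiv, integral_output θ hi', integral_output θ hi, integral_clip a hj'.1]
  exact integral_mono (hj'.comp_measurable (measurable_min_const a)) hj
    fun x => hmono (min_le_left x a)

lemma wardenDiv_clip_le (hμ : Integrable (fun x : ℝ≥0 => (x : ℝ)) μ) :
    wardenDiv (clip a μ) ≤ wardenDiv μ := by
  rw [wardenDiv, wardenDiv, wardenChannel, klDiv_output 1 hμ, klDiv_output 1 (integrable_clip a)]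
  exact ENNReal.ofReal_le_ofReal (outputDiv_clip_le 1 a hμ)

/-- Above `a` the increment is θ²(x - a) minus a nonnegative logarithmic increment, hence at most
θ²x. -/
lemma pointDiv_le_add (x : ℝ≥0) :
    pointDiv θ x ≤ pointDiv θ (min x a) + θ ^ 2 * (Set.Ioi a).indicator (fun x => (x : ℝ)) x := by
  rcases le_or_gt x a with h | h
  · simp [h]
  · rw [min_eq_right h.le, Set.indicator_of_mem (Set.mem_Ioi.mpr h)]
    have hax : (a : ℝ) ≤ x := by exact_mod_cast h.le
    have h1 : Real.log (θ ^ 2 * a + 1) ≤ Real.log (θ ^ 2 * x + 1) :=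
      Real.log_le_log (by positivity) (by gcongr)
    have h2 : 0 ≤ θ ^ 2 * (a : ℝ) := by positivity
    unfold pointDiv
    linarith

/-- The information lost by clipping is controlled by the mean of the part cut off. -/
lemma mutualInfo_le_clip_add (hμ : Integrable (fun x : ℝ≥0 => (x : ℝ)) μ) :
    mutualInfo μ (fadingChannel θ) ≤ mutualInfo (clip a μ) (fadingChannel θ)
      + ENNReal.ofReal (θ ^ 2) * ∫⁻ x in Set.Ioi a, (x : ℝ≥0∞) ∂μ := by
  have hc := integrable_clip a (μ := μ)
  have hpc := integrable_pointDiv θ hc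
  have hind : Integrable ((Set.Ioi a).indicator fun x : ℝ≥0 => (x : ℝ)) μ :=
    hμ.indicator measurableSet_Ioi
  have htail : ENNReal.ofReal (θ ^ 2) * ∫⁻ x in Set.Ioi a, (x : ℝ≥0∞) ∂μ
      = ENNReal.ofReal (θ ^ 2 * ∫ x, (Set.Ioi a).indicator (fun x : ℝ≥0 => (x : ℝ)) x ∂μ) := by
    rw [ENNReal.ofReal_mul (by positivity), integral_indicator measurableSet_Ioi,
      ofReal_integral_eq_lintegral_ofReal hμ.integrableOn (ae_of_all _ fun x => x.2)]
    simp
  rw [mutualInfo_eq θ hμ, mutualInfo_eq θ hc, htail]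
  refine le_trans (ENNReal.ofReal_le_ofReal ?_) ENNReal.ofReal_add_le
  have h1 := outputDiv_clip_le θ a hμ
  have h2 : ∫ x, pointDiv θ x ∂μ ≤ ∫ x, pointDiv θ x ∂(clip a μ)
      + θ ^ 2 * ∫ x, (Set.Ioi a).indicator (fun x : ℝ≥0 => (x : ℝ)) x ∂μ := by
    have hpm : Integrable (fun x => pointDiv θ (min x a)) μ :=
      hpc.comp_measurable (measurable_min_const a)
    rw [integral_clip a hpc.1, ← integral_const_mul, ← integral_add hpm (hind.const_mul _)]
    exact integral_mono (integrable_pointDiv θ hμ) (hpm.add (hind.const_mul _))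
      (pointDiv_le_add θ a)
  linarith

end Clip

/-! ### The input mean above the clipping level. -/

section Tail

variable (μ : Measure ℝ≥0) [IsProbabilityMeasure μ]

/-- This is the variational bound for the test function (z - T)⁺/2. Memorylessness extracts the
factor exp(-rT) on each side; what remains is half the output mean on the left and E[e^(Z/2) - 1] ≤
2 on the right, with Z standard exponential. -/
lemma lintegral_exp_le_wardenDiv_add {T : ℝ} (hT : 0 ≤ T) :
    ∫⁻ x : ℝ≥0, ENNReal.ofReal (Real.exp (-(rate 1 x * T)) * ((x + 1) / 2)) ∂μ
      ≤ wardenDiv μ + ENNReal.ofReal (2 * Real.exp (-T)) := by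
  have : IsMarkovKernel wardenChannel := inferInstanceAs (IsMarkovKernel (fadingChannel 1))
  set g : ℝ → ℝ := fun y => max y 0 / 2 with hg
  have hgm : Measurable g := by fun_prop
  have hg0 : ∀ y, 0 ≤ g y := fun y => by positivity
  have hneg : ∀ y < 0, g y = 0 := fun y hy => by simp [hg, max_eq_right hy.le]
  have h := lintegral_le_klDiv_add (wardenChannel ∘ₘ μ) (wardenChannel 0)
    (g := fun y => g (y - T)) (by fun_prop) (fun y => hg0 _)
  refine le_trans (le_of_eq ?_) (h.trans (add_le_add le_rfl ?_))
  · rw [Measure.lintegral_bind wardenChannel.aemeasurable (by fun_prop)]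
    refine lintegral_congr fun x => ?_
    have hr := rate_pos 1 x
    have hs := lintegral_expMeasure_shift (rate 1 x) hT (f := fun y => ENNReal.ofReal (g y))
      (by fun_prop) (fun y hy => by simp [hneg y hy])
    have hmean : ∫⁻ y, ENNReal.ofReal (g y) ∂(expMeasure (rate 1 x))
        = ENNReal.ofReal ((x + 1) / 2) := by
      have : ∀ᵐ y ∂(expMeasure (rate 1 x)),
          ENNReal.ofReal (g y) = ENNReal.ofReal (1 / 2) * ENNReal.ofReal y := by
        filter_upwards [ae_nonneg_expMeasure (rate 1 x)] with y hy
        rw [← ENNReal.ofReal_mul (by norm_num)]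
        simp only [hg, max_eq_left hy]
        ring_nf
      rw [lintegral_congr_ae this, lintegral_const_mul' _ _ ENNReal.ofReal_ne_top,
        lintegral_id_expMeasure hr, ← ENNReal.ofReal_mul (by norm_num), one_div_rate]
      ring_nf
    rw [hmean, ← ENNReal.ofReal_mul (Real.exp_pos _).le] at hs
    exact hs.symm
  · have hs := lintegral_expMeasure_shift (rate 1 0) hT
      (f := fun y => ENNReal.ofReal (Real.exp (g y) - 1))
      (by fun_prop) (fun y hy => by simp [hneg y hy])
    rw [rate_zero] at hs
    have h2 : ∫⁻ y, ENNReal.ofReal (Real.exp (g y) - 1) ∂(expMeasure 1) ≤ 2 := by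
      rw [← lintegral_exp_half_expMeasure_one]
      refine lintegral_mono_ae ?_
      filter_upwards [ae_nonneg_expMeasure 1] with y hy
      refine ENNReal.ofReal_le_ofReal ?_
      simp only [hg, max_eq_left hy]
      linarith
    rw [wardenChannel, fadingChannel_apply, rate_zero, hs, one_mul, mul_comm (2 : ℝ),
      ENNReal.ofReal_mul (Real.exp_pos _).le, ENNReal.ofReal_ofNat]
    gcongr

variable {μ}

/-- The threshold T = 0 already bounds the input mean by the divergence plus a constant. -/
lemma integrable_of_wardenDiv_lt_top (h : wardenDiv μ < ∞) :
    Integrable (fun x : ℝ≥0 => (x : ℝ)) μ := by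
  have h0 := lintegral_exp_le_wardenDiv_add μ le_rfl
  have hlt : ∫⁻ x : ℝ≥0, ENNReal.ofReal (Real.exp (-(rate 1 x * 0)) * ((x + 1) / 2)) ∂μ < ∞ :=
    h0.trans_lt (ENNReal.add_lt_top.mpr ⟨h, ENNReal.ofReal_lt_top⟩)
  have hi : Integrable (fun x : ℝ≥0 => ((x : ℝ) + 1) / 2) μ := by
    refine ⟨by fun_prop, ?_⟩
    rw [hasFiniteIntegral_iff_ofReal (ae_of_all _ fun x => by positivity)]
    simpa using hlt
  refine ((hi.const_mul 2).sub (integrable_const 1)).congr (ae_of_all _ fun x => ?_)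
  simp only [Pi.sub_apply]
  ring

/-- The mean of the part of the input above `a` is bounded by a power of the relative entropy at
the warden. -/
lemma setLIntegral_Ioi_le {a : ℝ≥0} {d : ℝ} (hd : 0 < d) (hd1 : d ≤ 1)
    (h : wardenDiv μ ≤ ENNReal.ofReal d) :
    ∫⁻ x in Set.Ioi a, (x : ℝ≥0∞) ∂μ ≤ ENNReal.ofReal (6 * d ^ ((a : ℝ) / (a + 1))) := by
  -- With T = -log d, `u` is exp(-T/(a+1)), a lower bound for the factor exp(-T/(x+1)) at every x >
  -- a.
  set u : ℝ := d ^ (1 / ((a : ℝ) + 1)) with hu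
  have hu0 : 0 < u := Real.rpow_pos_of_pos hd _
  have hT : 0 ≤ -Real.log d := by linarith [Real.log_nonpos hd.le hd1]
  have hmain := lintegral_exp_le_wardenDiv_add μ hT
  have hlow : ENNReal.ofReal (u / 2) * ∫⁻ x in Set.Ioi a, (x : ℝ≥0∞) ∂μ
      ≤ ∫⁻ x : ℝ≥0,
        ENNReal.ofReal (Real.exp (-(rate 1 x * -Real.log d)) * ((x + 1) / 2)) ∂μ := by
    rw [← lintegral_const_mul' _ _ ENNReal.ofReal_ne_top]
    refine le_trans (setLIntegral_mono' measurableSet_Ioi fun x hx => ?_)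
      (setLIntegral_le_lintegral (Set.Ioi a) _)
    rw [← ENNReal.ofReal_coe_nnreal, ← ENNReal.ofReal_mul (by positivity)]
    refine ENNReal.ofReal_le_ofReal ?_
    have hexp : u ≤ Real.exp (-(rate 1 x * -Real.log d)) := by
      rw [hu, Real.rpow_def_of_pos hd]
      refine Real.exp_le_exp.mpr ?_
      have hr : rate 1 x ≤ 1 / ((a : ℝ) + 1) := by
        have := rate_antitone 1 (Set.mem_Ioi.mp hx).le
        simpa [rate] using this
      have := mul_le_mul_of_nonneg_right hr hT
      linarith
    calc u / 2 * (x : ℝ) = u * (x / 2) := by ring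
      _ ≤ _ := by gcongr; linarith
  have hexp2 : 2 * Real.exp (-(-Real.log d)) = 2 * d := by rw [neg_neg, Real.exp_log hd]
  -- The total on the right is d + 2e^(-T) = 3d; dividing by u/2 produces the constant 6 and the
  -- exponent 1 - 1/(a+1).
  have hud : 6 * d ^ ((a : ℝ) / (a + 1)) = 3 * d / (u / 2) := by
    have : u * d ^ ((a : ℝ) / (a + 1)) = d := by
      rw [hu, ← Real.rpow_add hd, ← add_div, add_comm 1 (a : ℝ),
        div_self (by positivity), Real.rpow_one]
    rw [eq_div_iff (by positivity)]
    linear_combination 3 * this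
  rw [hud, ENNReal.ofReal_div_of_pos (by positivity), ENNReal.le_div_iff_mul_le
    (Or.inl (by simpa using hu0)) (Or.inl ENNReal.ofReal_ne_top), mul_comm]
  refine hlow.trans (hmain.trans ?_)
  rw [hexp2]
  refine (add_le_add h le_rfl).trans (le_of_eq ?_)
  rw [← ENNReal.ofReal_add hd.le (by positivity)]
  ring_nf

lemma infoRatio_le_clip_add (θ : ℝ) {a : ℝ≥0} (ha : 1 < a) {d : ℝ} (hd : 0 < d) (hd1 : d ≤ 1)
    (h : wardenDiv μ ≤ ENNReal.ofReal d) :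
    infoRatio θ μ ≤ infoRatio θ (clip a μ)
      + ENNReal.ofReal (6 * θ ^ 2 * d ^ ((a : ℝ) / (a + 1) - 1 / 2)) := by
  have hμ := integrable_of_wardenDiv_lt_top (h.trans_lt ENNReal.ofReal_lt_top)
  have ha' : (1 : ℝ) < a := by exact_mod_cast ha
  have hexp : 0 < (a : ℝ) / (a + 1) - 1 / 2 := by
    rw [sub_pos, div_lt_div_iff₀ two_pos (by positivity)]
    linarith
  have hpos : (0 : ℝ) < a / (a + 1) := by positivity
  rw [infoRatio, infoRatio]
  refine (ENNReal.div_le_div_right (mutualInfo_le_clip_add θ a hμ) _).trans ?_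
  rw [ENNReal.add_div]
  refine add_le_add (ENNReal.div_le_div_left
    (ENNReal.rpow_le_rpow (wardenDiv_clip_le a hμ) (by norm_num)) _) ?_
  -- At zero divergence the quotient must be handled separately: the tail bound holds for every
  -- small e > 0, so the tail vanishes, and 0/0 is 0 in `ℝ≥0∞`.
  rcases eq_or_ne (wardenDiv μ) 0 with h0 | h0
  · have hzero : ∫⁻ x in Set.Ioi a, (x : ℝ≥0∞) ∂μ = 0 := by
      have hlim : Filter.Tendsto (fun e : ℝ => ENNReal.ofReal (6 * e ^ ((a : ℝ) / (a + 1))))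
          (nhdsWithin 0 (Set.Ioi 0)) (nhds 0) := by
        have hc : Continuous fun e : ℝ => 6 * e ^ ((a : ℝ) / (a + 1)) :=
          continuous_const.mul (Real.continuous_rpow_const hpos.le)
        have := (ENNReal.continuous_ofReal.comp hc).tendsto 0
        simp only [Function.comp_def, Real.zero_rpow hpos.ne', mul_zero, ENNReal.ofReal_zero]
          at this
        exact this.mono_left nhdsWithin_le_nhds
      refine le_antisymm (ge_of_tendsto hlim ?_) zero_le
      filter_upwards [Ioo_mem_nhdsGT (zero_lt_one' ℝ)] with e he
      exact setLIntegral_Ioi_le he.1 he.2.le (h0 ▸ zero_le)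
    simp [hzero]
  · have htop : wardenDiv μ ≠ ∞ := (h.trans_lt ENNReal.ofReal_lt_top).ne
    obtain ⟨e, he0, he⟩ : ∃ e : ℝ, 0 < e ∧ wardenDiv μ = ENNReal.ofReal e :=
      ⟨_, ENNReal.toReal_pos h0 htop, (ENNReal.ofReal_toReal htop).symm⟩
    -- The tail bound is applied at the actual divergence `e`, which is the one in the denominator;
    -- positivity of the remaining exponent then allows passing from `e` to `d`.
    have hed : e ≤ d := (ENNReal.ofReal_le_ofReal_iff hd.le).mp (he ▸ h)
    have ht := setLIntegral_Ioi_le (a := a) he0 (hed.trans hd1) he.le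
    rw [he, ENNReal.ofReal_rpow_of_pos he0]
    refine (ENNReal.div_le_div_right (mul_le_mul_right ht _) _).trans ?_
    rw [← ENNReal.ofReal_mul (by positivity),
      ← ENNReal.ofReal_div_of_pos (Real.rpow_pos_of_pos he0 _)]
    refine ENNReal.ofReal_le_ofReal ?_
    calc θ ^ 2 * (6 * e ^ ((a : ℝ) / (a + 1))) / e ^ (1 / 2 : ℝ)
        = 6 * θ ^ 2 * e ^ ((a : ℝ) / (a + 1) - 1 / 2) := by rw [Real.rpow_sub he0]; ring
      _ ≤ _ := by
        gcongr

end Tail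

end

end CovertRayleigh

/-! ### Passage to the limit along vanishing divergence constraints. -/

theorem theorem3 (θ : ℝ) (hθ : 0 < θ)
    (ν : ℕ → ℝ) (hν_pos : ∀ n, 0 < ν n)
    (hν : Filter.Tendsto ν Filter.atTop (nhds 0))
    (μ : ℕ → Measure ℝ≥0) (hμ : ∀ n, CovertRayleigh.IsOptimal θ (ν n) (μ n))
    (a : ℝ≥0) (ha : 1 < a) :
    (∀ᶠ n in Filter.atTop,
      CovertRayleigh.clip a (μ n) ∈ CovertRayleigh.feasibleAmp a (ν n)) ∧
    Filter.liminf (fun n => CovertRayleigh.infoRatio θ (μ n)) Filter.atTop ≤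
      Filter.liminf (fun n => CovertRayleigh.infoRatio θ (CovertRayleigh.clip a (μ n)))
        Filter.atTop := by
  have hprob : ∀ n, IsProbabilityMeasure (μ n) := fun n => (hμ n).1.1.1
  have hdiv : ∀ n, CovertRayleigh.wardenDiv (μ n) ≤ ENNReal.ofReal (ν n) := fun n => (hμ n).1.2
  have hclip : ∀ n, CovertRayleigh.wardenDiv (CovertRayleigh.clip a (μ n))
      ≤ CovertRayleigh.wardenDiv (μ n) := fun n =>
    CovertRayleigh.wardenDiv_clip_le a
      (CovertRayleigh.integrable_of_wardenDiv_lt_top (hμ n).1.1.2)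
  refine ⟨Filter.Eventually.of_forall fun n => ⟨⟨⟨inferInstance, ?_⟩, ?_⟩, ?_⟩, ?_⟩
  · exact (hclip n).trans_lt (hμ n).1.1.2
  · exact (hclip n).trans (hdiv n)
  · exact CovertRayleigh.clip_Ioi a
  have ha' : (1 : ℝ) < a := by exact_mod_cast ha
  have hexp : 0 < (a : ℝ) / (a + 1) - 1 / 2 := by
    rw [sub_pos, div_lt_div_iff₀ two_pos (by positivity)]
    linarith
  have herr : Filter.Tendsto
      (fun n => ENNReal.ofReal (6 * θ ^ 2 * ν n ^ ((a : ℝ) / (a + 1) - 1 / 2)))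
      Filter.atTop (nhds 0) := by
    have h := (hν.rpow_const (Or.inr hexp.le)).const_mul (6 * θ ^ 2)
    rw [Real.zero_rpow hexp.ne', mul_zero] at h
    simpa using ENNReal.tendsto_ofReal h
  -- Adding a null sequence does not change the lower limit, so an eventual termwise comparison with
  -- the error included suffices.
  rw [← ENNReal.liminf_add_of_right_tendsto_zero herr
    (fun n => CovertRayleigh.infoRatio θ (CovertRayleigh.clip a (μ n)))]
  refine Filter.liminf_le_liminf ?_
  filter_upwards [hν.eventually_le_const zero_lt_one] with n hn
  exact CovertRayleigh.infoRatio_le_clip_add θ ha (hν_pos n) hn (hdiv n)
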